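/- Setting. For finite positive Borel measures $\mu,\nu$ on $\mathbb C$ with $\int\log(1+|t|)\,d\mu(t)<\infty$ and $\int\log(1+|t|)\,d\nu(t)<\infty$, let $$U^\mu(z)=\int\log\frac1{|z-x|}\,d\mu(x)\in(-\infty,\infty],\qquad I(\mu,\nu)=\iint\log\frac1{|x-y|}\,d\mu(x)\,d\nu(y)\in(-\infty,\infty],\qquad I(\mu)=I(\mu,\mu).$$ For $E\subset\mathbb C$, let $\mathrm{cap}(E)=\sup e^{-I(\sigma)}$, the supremum being over all Borel probability measures $\sigma$ with compact support contained in $E$. For a closed set $\Sigma\subset\mathbb C$, let $\mathcal M(\Sigma)$ be the set of finite positive Borel measures $\mu$ supported in $\Sigma$ with $\int\log(1+|t|)\,d\mu(t)<\infty$ and $I(\mu)<\infty$. A function $f:\Sigma\to(-\infty,\infty]$ is called admissible if it is lower semicontinuous, if $\{x\in\Sigma: f(x)<\infty\}$ has positive capacity, and if (in case $\Sigma$ is unbounded) $f(x)/\log|x|\to\infty$ as $|x|\to\infty$, $x\in\Sigma$. Let $\Delta_1,\dots,\Delta_d\subset\mathbb C$ be closed sets of positive capacity with $\bigcup_i\Delta_i\neq\mathbb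 C$, let $C=(c_{i,j})\in\mathbb R^{d\times d}$ be symmetric positive semidefinite, let $K\subset\mathbb R^d_+$ be nonempty and compact, where $\mathbb R_+=[0,\infty)$, and let $Q_i:\Delta_i\to(-\infty,\infty]$, $i=1,\dots,d$, be admissible. Let $\mathcal M_K^d(\Delta)$ be the set of tuples $\mu=(\mu_1,\dots,\mu_d)$ with $\mu_i\in\mathcal M(\Delta_i)$ for all $i$ and $(\mu_1(\mathbb C),\dots,\mu_d(\mathbb C))\in K$, and for such $\mu$ put $$J_Q(\mu)=\sum_{i,j=1}^d c_{i,j}\,I(\mu_i,\mu_j)+2\sum_{j=1}^d\int Q_j\,d\mu_j .$$ Theorem. Let $\mu\in\mathcal M_K^d(\Delta)$ be a solution of the minimization problem, that is, $J_Q(\mu)=\inf\{J_Q(\nu):\nu\in\mathcal M_K^d(\Delta)\}$. Then all components $\mu_1,\dots,\mu_d$ have compact support if and only if the following holds: there exist $\alpha\in\mathbb R$ and $M>0$ such that, for all pairs $(i,j)$ with $\Delta_i$ and $\Delta_j$ unbounded and $c_{i,j}<0$, $$c_{i,j}\,U^{\mu_j}(z)+\frac1d\,Q_i(z)\ \ge\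 \alpha\qquad\text{for }\mu_i\text{-almost every } z\in\Delta_i\setminus D_M,$$ where $D_M=\{z\in\mathbb C:|z|\le M\}$. -/

import Mathlib

open MeasureTheory Filter Topology
open scoped ENNReal

namespace VectorEquilibrium

/-- The integral `∫ f dμ ∈ [-∞, ∞]` of an extended real valued function, as the integral of its
positive part minus the integral of its negative part. It is the usual integral whenever one of
the two parts has a finite integral, which is the case wherever it is used below. -/
noncomputable def extIntegral {X : Type*} [MeasurableSpace X] (μ : Measure X) (f : X → EReal) :
    EReal :=
  ((∫⁻ x, (f x).toENNReal ∂μ : ℝ≥0∞) : EReal) - ((∫⁻ x, (-f x).toENNReal ∂μ : ℝ≥0∞) : EReal)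

/-- The logarithmic kernel `log (1 / |z - w|) ∈ (-∞, ∞]`, with value `+∞` for `z = w`. -/
noncomputable def logKernel (z w : ℂ) : EReal :=
  ENNReal.log (‖z - w‖ₑ)⁻¹

/-- The logarithmic potential `U^μ (z) = ∫ log (1 / |z - x|) dμ(x)`. -/
noncomputable def potential (μ : Measure ℂ) (z : ℂ) : EReal :=
  extIntegral μ (fun x => logKernel z x)

/-- The mutual energy `I(μ, ν) = ∬ log (1 / |x - y|) dμ(x) dν(y)`. -/
noncomputable def mutualEnergy (μ ν : Measure ℂ) : EReal :=
  extIntegral (μ.prod ν) (fun p => logKernel p.1 p.2)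

/-- The logarithmic capacity of a set `E`: the supremum of `exp (- I(μ))` over the Borel
probability measures `μ` with compact support contained in `E`. -/
noncomputable def logCapacity (E : Set ℂ) : ℝ≥0∞ :=
  ⨆ (μ : Measure ℂ) (_ : IsProbabilityMeasure μ) (_ : IsCompact μ.support) (_ : μ.support ⊆ E),
    EReal.exp (-mutualEnergy μ μ)

/-- The set `ℳ(S)`: Borel measures of finite mass, supported in `S`, with
`∫ log (1 + |t|) dμ(t) < ∞` and of finite energy. -/
def measureClass (S : Set ℂ) : Set (Measure ℂ) :=
  {μ | IsFiniteMeasure μ ∧ μ.support ⊆ S ∧ Integrable (fun t : ℂ => Real.log (1 + ‖t‖)) μ ∧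
    mutualEnergy μ μ < ⊤}

/-- The set `ℳ_K^d(Δ)`: tuples `μ` with `μ i ∈ ℳ(Δ i)` whose vector of masses lies in `K`. -/
def tupleClass {d : ℕ} (Δ : Fin d → Set ℂ) (K : Set (Fin d → ℝ)) : Set (Fin d → Measure ℂ) :=
  {μ | (∀ i, μ i ∈ measureClass (Δ i)) ∧ (fun i => (μ i).real Set.univ) ∈ K}

/-- Admissible external fields on `S`. The field is a function on `S` with values in `(-∞, ∞]`;
only the values of `f` on `S` play a role. The last condition is void if `S` is bounded. -/
structure Admissible (S : Set ℂ) (f : ℂ → EReal) : Prop where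
  ne_bot : ∀ x ∈ S, f x ≠ ⊥
  lowerSemicontinuousOn : LowerSemicontinuousOn f S
  finite_on_pos_capacity : 0 < logCapacity {x ∈ S | f x < ⊤}
  growth : Tendsto (fun x => f x / ((Real.log ‖x‖ : ℝ) : EReal))
    (Bornology.cobounded ℂ ⊓ 𝓟 S) (𝓝 ⊤)

/-- The energy `J(μ) = ∑ i j, c_{i,j} I(μ_i, μ_j)` of a tuple of measures. -/
noncomputable def energy {d : ℕ} (C : Matrix (Fin d) (Fin d) ℝ) (μ : Fin d → Measure ℂ) : EReal :=
  ∑ i, ∑ j, (C i j : EReal) * mutualEnergy (μ i) (μ j)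

/-- The weighted energy `J_Q(μ) = J(μ) + 2 ∑ j, ∫ Q_j dμ_j`. -/
noncomputable def weightedEnergy {d : ℕ} (C : Matrix (Fin d) (Fin d) ℝ) (Q : Fin d → ℂ → EReal)
    (μ : Fin d → Measure ℂ) : EReal :=
  energy C μ + 2 * ∑ j, extIntegral (μ j) (Q j)

/-- `μ` solves the minimization problem for `J_Q` over `ℳ_K^d(Δ)`: it belongs to this set and
attains the infimum. -/
def IsSolution {d : ℕ} (C : Matrix (Fin d) (Fin d) ℝ) (Δ : Fin d → Set ℂ) (K : Set (Fin d → ℝ))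
    (Q : Fin d → ℂ → EReal) (μ : Fin d → Measure ℂ) : Prop :=
  μ ∈ tupleClass Δ K ∧ weightedEnergy C Q μ = ⨅ ν ∈ tupleClass Δ K, weightedEnergy C Q ν

end VectorEquilibrium

/-! If all supports are compact, take `M` so large that `D_M` contains them; the tail condition is
then vacuous.

The converse rests on a one-sided Euler–Lagrange inequality. Moving one component `μ i` towards a
competitor of equal mass keeps the mass vector in `K`, and the energy along this segment is a
quadratic polynomial, so its derivative at `0` is nonnegative. Competitors obtained by restricting
`μ i` and rescaling give `∑ l, C i l * U^{μ l} + Q i ≤ F` almost everywhere for `μ i`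
(`IsSolution.exists_ae_totalPotential_le`).

Now split `Q i` into `d` equal shares and give one to each `j ≠ i`. Each resulting term is at least
`-A (1 + log (1 + |z|))` far out: directly if `C i j ≥ 0` or `Δ j` is bounded, by the tail condition
otherwise (`exists_ae_component_lower_bound`). The diagonal term needs no share because `C i i ≥ 0`.
One share of `Q i` is left over; it outgrows every multiple of `log |z|`, which contradicts the
bound `F` for large `|z|`.

To expand the energy, mutual energies must be finite also from above, since coefficients may be
negative. This is `integrable_realKernel`, proved by comparing the masses that the product measures
give to neighbourhoods of the diagonal. -/

namespace VectorEquilibrium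

/-! ### Extended integrals and Bochner integrals. -/

section ExtIntegral

variable {X : Type*} [MeasurableSpace X] {μ : Measure X} {f : X → EReal}

theorem extIntegral_eq_coe_integral {g : X → ℝ} (hfg : ∀ᵐ x ∂μ, f x = g x)
    (hg : Integrable g μ) : extIntegral μ f = ((∫ x, g x ∂μ : ℝ) : EReal) := by
  have h1 : ∫⁻ x, (f x).toENNReal ∂μ = ∫⁻ x, ENNReal.ofReal (g x) ∂μ :=
    lintegral_congr_ae <| hfg.mono fun x hx => by simp only [hx, EReal.real_coe_toENNReal]
  have h2 : ∫⁻ x, (-f x).toENNReal ∂μ = ∫⁻ x, ENNReal.ofReal (-g x) ∂μ :=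
    lintegral_congr_ae <| hfg.mono fun x hx => by
      simp only [hx, ← EReal.coe_neg, EReal.real_coe_toENNReal]
  have f1 : ∫⁻ x, ENNReal.ofReal (g x) ∂μ ≠ ⊤ := hg.lintegral_lt_top.ne
  have f2 : ∫⁻ x, ENNReal.ofReal (-g x) ∂μ ≠ ⊤ := hg.neg.lintegral_lt_top.ne
  rw [extIntegral, h1, h2, ← EReal.coe_ennreal_toReal f1, ← EReal.coe_ennreal_toReal f2,
    integral_eq_lintegral_pos_part_sub_lintegral_neg_part hg, EReal.coe_sub]

/-- With a finite negative part there is no `⊤ - ⊤`, so an infinite positive part would force the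
value `⊤`. -/
theorem ae_coe_toReal_and_integrable_of_extIntegral_ne_top (hf : AEMeasurable f μ)
    (hneg : ∫⁻ x, (-f x).toENNReal ∂μ ≠ ⊤) (h : extIntegral μ f ≠ ⊤) :
    (∀ᵐ x ∂μ, f x = ((f x).toReal : EReal)) ∧ Integrable (fun x => (f x).toReal) μ := by
  have hpos : ∫⁻ x, (f x).toENNReal ∂μ ≠ ⊤ := by
    intro htop
    apply h
    rw [extIntegral, htop, ← EReal.coe_ennreal_toReal hneg, EReal.coe_ennreal_top,
      EReal.top_sub_coe]
  have m1 : AEMeasurable (fun x => (f x).toENNReal) μ := hf.ereal_toENNReal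
  have m2 : AEMeasurable (fun x => (-f x).toENNReal) μ := hf.neg.ereal_toENNReal
  have hae : ∀ᵐ x ∂μ, f x = ((f x).toReal : EReal) := by
    filter_upwards [ae_lt_top' m1 hpos, ae_lt_top' m2 hneg] with x h1 h2
    rw [EReal.coe_toReal]
    · exact fun hx => by simp [hx] at h1
    · exact fun hx => by simp [hx] at h2
  refine ⟨hae, hf.ereal_toReal.aestronglyMeasurable, ?_⟩
  have hle : ∫⁻ x, ‖(f x).toReal‖ₑ ∂μ
      ≤ ∫⁻ x, ((f x).toENNReal + (-f x).toENNReal) ∂μ := by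
    refine lintegral_mono_ae (hae.mono fun x hx => ?_)
    rw [hx]
    simp only [EReal.toReal_coe, ← EReal.coe_neg, EReal.real_coe_toENNReal]
    rw [Real.enorm_eq_ofReal_abs]
    rcases le_total 0 (f x).toReal with h0 | h0
    · rw [abs_of_nonneg h0]; exact le_self_add
    · rw [abs_of_nonpos h0]; exact le_add_self
  refine hle.trans_lt ?_
  rw [lintegral_add_left' m1]
  exact ENNReal.add_lt_top.2 ⟨hpos.lt_top, hneg.lt_top⟩

theorem extIntegral_ne_bot (hneg : ∫⁻ x, (-f x).toENNReal ∂μ ≠ ⊤) : extIntegral μ f ≠ ⊥ := by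
  rw [extIntegral, ← EReal.coe_ennreal_toReal hneg, sub_eq_add_neg, ← EReal.coe_neg, Ne,
    EReal.add_eq_bot_iff, not_or]
  exact ⟨EReal.coe_ennreal_ne_bot _, EReal.coe_ne_bot _⟩

end ExtIntegral

/-! ### The logarithmic kernel and its lower bound. -/

section Kernel

/-- The logarithmic kernel as a real valued function, equal to `logKernel` off the diagonal. -/
noncomputable def realKernel (z w : ℂ) : ℝ := -Real.log ‖z - w‖

theorem realKernel_comm (z w : ℂ) : realKernel z w = realKernel w z := by
  rw [realKernel, realKernel, norm_sub_rev]

theorem logKernel_of_ne {z w : ℂ} (h : z ≠ w) : logKernel z w = realKernel z w := by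
  have h0 : 0 < ‖z - w‖ := norm_pos_iff.2 (sub_ne_zero.2 h)
  rw [logKernel, ENNReal.log_inv, ← ofReal_norm, ENNReal.log_ofReal_of_pos h0,
    realKernel, EReal.coe_neg]

theorem logKernel_self (z : ℂ) : logKernel z z = ⊤ := by
  simp [logKernel]

theorem measurable_realKernel : Measurable fun p : ℂ × ℂ => realKernel p.1 p.2 := by
  unfold realKernel
  fun_prop

theorem measurable_logKernel : Measurable fun p : ℂ × ℂ => logKernel p.1 p.2 := by
  unfold logKernel
  exact ENNReal.log_monotone.measurable.comp (by fun_prop)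

theorem norm_sub_le_mul (z w : ℂ) : ‖z - w‖ ≤ (1 + ‖z‖) * (1 + ‖w‖) := by
  have := norm_sub_le z w
  nlinarith [norm_nonneg z, norm_nonneg w, mul_nonneg (norm_nonneg z) (norm_nonneg w)]

/-- From `|z - w| ≤ (1 + |z|)(1 + |w|)`. The log-moment condition thus controls the negative part of
the kernel. On the diagonal `realKernel` is `0`, since `Real.log 0 = 0`. -/
theorem neg_realKernel_le (z w : ℂ) :
    -realKernel z w ≤ Real.log (1 + ‖z‖) + Real.log (1 + ‖w‖) := by
  have hz : 0 < 1 + ‖z‖ := by positivity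
  have hw : 0 < 1 + ‖w‖ := by positivity
  rw [realKernel, neg_neg, ← Real.log_mul hz.ne' hw.ne']
  rcases (norm_nonneg (z - w)).eq_or_lt with h | h
  · rw [← h, Real.log_zero]
    exact Real.log_nonneg (by nlinarith [norm_nonneg z, norm_nonneg w])
  · exact Real.log_le_log h (norm_sub_le_mul z w)

theorem log_one_add_norm_nonneg (z : ℂ) : 0 ≤ Real.log (1 + ‖z‖) :=
  Real.log_nonneg (by linarith [norm_nonneg z])

theorem neg_logKernel_toENNReal_le (z w : ℂ) : (-logKernel z w).toENNReal
    ≤ ENNReal.ofReal (Real.log (1 + ‖z‖) + Real.log (1 + ‖w‖)) := by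
  rcases eq_or_ne z w with rfl | h
  · simp [logKernel_self]
  · rw [logKernel_of_ne h, ← EReal.coe_neg, EReal.real_coe_toENNReal]
    exact ENNReal.ofReal_le_ofReal (neg_realKernel_le z w)

end Kernel

/-! ### Product measures near the diagonal. -/

section NearDiagonal

variable {μ ν : Measure ℂ}

/-- The set of pairs at distance less than `r`. -/
def nearDiagonal (r : ℝ) : Set (ℂ × ℂ) := {p | dist p.1 p.2 < r}

theorem measurableSet_nearDiagonal (r : ℝ) : MeasurableSet (nearDiagonal r) :=
  (isOpen_lt (by fun_prop) continuous_const).measurableSet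

/-- Tonelli for the set of `(u, (x, y))` with both `x` and `y` within `r` of `u`. -/
theorem lintegral_measure_ball_mul [SFinite μ] [SFinite ν] (r : ℝ) :
    ∫⁻ u : ℂ, μ (Metric.ball u r) * ν (Metric.ball u r)
      = ∫⁻ p, volume (Metric.ball p.1 r ∩ Metric.ball p.2 r) ∂(μ.prod ν) := by
  have hW : MeasurableSet {q : ℂ × (ℂ × ℂ) | dist q.2.1 q.1 < r ∧ dist q.2.2 q.1 < r} := by
    have h1 : IsOpen {q : ℂ × (ℂ × ℂ) | dist q.2.1 q.1 < r} :=
      isOpen_lt (by fun_prop) continuous_const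
    have h2 : IsOpen {q : ℂ × (ℂ × ℂ) | dist q.2.2 q.1 < r} :=
      isOpen_lt (by fun_prop) continuous_const
    exact (h1.inter h2).measurableSet
  have e1 := Measure.prod_apply (μ := (volume : Measure ℂ)) (ν := μ.prod ν) hW
  have e2 := Measure.prod_apply_symm (μ := (volume : Measure ℂ)) (ν := μ.prod ν) hW
  rw [e1] at e2
  convert e2 using 2
  · ext u
    rw [← Measure.prod_prod]
    rfl
  · ext p
    congr 1
    ext u
    simp [dist_comm u]

theorem volume_ball_half (x y : ℂ) (r : ℝ) : volume (Metric.ball x r)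
    = 4 * volume (Metric.ball y (r / 2)) := by
  have h : ENNReal.ofReal r = 2 * ENNReal.ofReal (r / 2) := by
    rw [← ENNReal.ofReal_ofNat 2, ← ENNReal.ofReal_mul (by norm_num)]
    congr 1
    ring
  rw [Complex.volume_ball, Complex.volume_ball, h]
  ring

theorem lintegral_measure_ball_sq_le [SFinite μ] (r : ℝ) :
    ∫⁻ u : ℂ, μ (Metric.ball u r) * μ (Metric.ball u r)
      ≤ volume (Metric.ball (0 : ℂ) r) * μ.prod μ (nearDiagonal (2 * r)) := by
  rw [lintegral_measure_ball_mul, ← setLIntegral_const,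
    ← lintegral_indicator (measurableSet_nearDiagonal _)]
  refine lintegral_mono fun p => ?_
  by_cases hp : p ∈ nearDiagonal (2 * r)
  · rw [Set.indicator_of_mem hp]
    refine (measure_mono Set.inter_subset_left).trans_eq ?_
    simp only [Complex.volume_ball]
  · rw [Set.indicator_of_notMem hp]
    suffices h : Metric.ball p.1 r ∩ Metric.ball p.2 r = ∅ by rw [h, measure_empty]
    ext u
    simp only [Set.mem_inter_iff, Metric.mem_ball, Set.mem_empty_iff_false, iff_false, not_and]
    intro h1 h2
    apply hp
    have := dist_triangle_left p.1 p.2 u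
    simp only [nearDiagonal, Set.mem_ofPred_eq]
    linarith

theorem le_lintegral_measure_ball_mul [SFinite μ] [SFinite ν] (r : ℝ) :
    volume (Metric.ball (0 : ℂ) (r / 2)) * μ.prod ν (nearDiagonal r)
      ≤ ∫⁻ u : ℂ, μ (Metric.ball u r) * ν (Metric.ball u r) := by
  rw [lintegral_measure_ball_mul, ← setLIntegral_const,
    ← lintegral_indicator (measurableSet_nearDiagonal _)]
  refine lintegral_mono fun p => ?_
  by_cases hp : p ∈ nearDiagonal r
  · rw [Set.indicator_of_mem hp]
    have hp' : dist p.1 p.2 < r := hp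
    -- Points at distance less than `r` have a midpoint within `r / 2` of both, so the ball of
    -- radius `r / 2` around it lies in both balls.
    have hsub : Metric.ball (midpoint ℝ p.1 p.2) (r / 2)
        ⊆ Metric.ball p.1 r ∩ Metric.ball p.2 r := by
      intro u hu
      have hu' : dist u (midpoint ℝ p.1 p.2) < r / 2 := hu
      have d1 : dist (midpoint ℝ p.1 p.2) p.1 = dist p.1 p.2 / 2 := by
        rw [dist_midpoint_left]; norm_num; ring
      have d2 : dist (midpoint ℝ p.1 p.2) p.2 = dist p.1 p.2 / 2 := by
        rw [dist_midpoint_right]; norm_num; ring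
      have t1 := dist_triangle u (midpoint ℝ p.1 p.2) p.1
      have t2 := dist_triangle u (midpoint ℝ p.1 p.2) p.2
      constructor <;> rw [Metric.mem_ball] <;> linarith
    refine le_trans (le_of_eq ?_) (measure_mono hsub)
    simp only [Complex.volume_ball]
  · rw [Set.indicator_of_notMem hp]
    exact zero_le

/-- Integrate `ab ≤ a² + b²` with `a = μ (B(u, r))`, `b = ν (B(u, r))` over `u`. The factor `4` is
the area ratio of discs of radius `r` and `r / 2`. -/
theorem prod_nearDiagonal_le [SFinite μ] [SFinite ν] {r : ℝ} (hr : 0 < r) :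
    μ.prod ν (nearDiagonal r)
      ≤ 4 * (μ.prod μ (nearDiagonal (2 * r)) + ν.prod ν (nearDiagonal (2 * r))) := by
  have hV0 : volume (Metric.ball (0 : ℂ) (r / 2)) ≠ 0 :=
    (Metric.measure_ball_pos _ _ (half_pos hr)).ne'
  have hVt : volume (Metric.ball (0 : ℂ) (r / 2)) ≠ ⊤ := measure_ball_lt_top.ne
  have hsq : ∀ a b : ℝ≥0∞, a * b ≤ a * a + b * b := fun a b => by
    rcases le_total a b with h | h
    · exact (mul_le_mul_left h b).trans le_add_self
    · exact (mul_le_mul_right h a).trans le_self_add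
  have key : volume (Metric.ball (0 : ℂ) (r / 2)) * μ.prod ν (nearDiagonal r)
      ≤ volume (Metric.ball (0 : ℂ) (r / 2))
        * (4 * (μ.prod μ (nearDiagonal (2 * r)) + ν.prod ν (nearDiagonal (2 * r)))) := by
    refine (le_lintegral_measure_ball_mul r).trans ?_
    refine (lintegral_mono fun u => hsq _ _).trans ?_
    rw [lintegral_add_left']
    · refine (add_le_add (lintegral_measure_ball_sq_le r)
        (lintegral_measure_ball_sq_le r)).trans_eq ?_
      rw [volume_ball_half 0 0 r]
      ring
    · have : Measurable fun u : ℂ => μ (Metric.ball u r) := by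
        have hW : MeasurableSet {q : ℂ × ℂ | dist q.2 q.1 < r} :=
          (isOpen_lt (by fun_prop) continuous_const).measurableSet
        exact measurable_measure_prodMk_left hW
      exact (this.mul this).aemeasurable
  exact (ENNReal.mul_le_mul_iff_right hV0 hVt).1 key

end NearDiagonal

/-! ### Measures of finite energy, their mutual energies and potentials. -/

section MeasureClass

variable {μ ν : Measure ℂ} {S T : Set ℂ}

theorem support_subset_iff_ae (hS : IsClosed S) : μ.support ⊆ S ↔ ∀ᵐ x ∂μ, x ∈ S :=
  ⟨fun h => mem_of_superset Measure.support_mem_ae h,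
    fun h => Measure.support_subset_of_isClosed hS h⟩

theorem ae_ne_of_nullSingletonClass [SFinite ν] [NullSingletonClass ν] : ∀ᵐ p ∂(μ.prod ν), p.1 ≠ p.2 := by
  have hm : MeasurableSet {p : ℂ × ℂ | p.1 = p.2} :=
    (isClosed_eq continuous_fst continuous_snd).measurableSet
  rw [ae_iff]
  simp only [ne_eq, not_not]
  rw [Measure.measure_prod_null hm]
  refine ae_of_all _ fun x => ?_
  have : Prod.mk x ⁻¹' {p : ℂ × ℂ | p.1 = p.2} = {x} := by
    ext y
    simp [eq_comm]
  change ν _ = 0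
  rw [this, measure_singleton]

/-- An atom at `x` would give positive product mass to the diagonal point `(x, x)`. -/
theorem nullSingletonClass_of_ae_ne [SFinite μ] (h : ∀ᵐ p ∂(μ.prod μ), p.1 ≠ p.2) : NullSingletonClass μ := by
  refine ⟨fun x => ?_⟩
  rw [ae_iff] at h
  simp only [ne_eq, not_not] at h
  have h2 : μ.prod μ ({x} ×ˢ {x}) = 0 := by
    refine measure_mono_null ?_ h
    rintro ⟨a, b⟩ ⟨ha, hb⟩
    simp only [Set.mem_singleton_iff] at ha hb
    simp [ha, hb]
  rw [Measure.prod_prod] at h2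
  simpa using h2

theorem integrable_log_add_log [IsFiniteMeasure μ] [IsFiniteMeasure ν]
    (hμ : Integrable (fun t : ℂ => Real.log (1 + ‖t‖)) μ)
    (hν : Integrable (fun t : ℂ => Real.log (1 + ‖t‖)) ν) :
    Integrable (fun p : ℂ × ℂ => Real.log (1 + ‖p.1‖) + Real.log (1 + ‖p.2‖)) (μ.prod ν) :=
  (hμ.comp_fst ν).add (hν.comp_snd μ)

theorem lintegral_neg_logKernel_ne_top [IsFiniteMeasure μ] [IsFiniteMeasure ν]
    (hμ : Integrable (fun t : ℂ => Real.log (1 + ‖t‖)) μ)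
    (hν : Integrable (fun t : ℂ => Real.log (1 + ‖t‖)) ν) :
    ∫⁻ p, (-logKernel p.1 p.2).toENNReal ∂(μ.prod ν) ≠ ⊤ :=
  ne_top_of_le_ne_top (integrable_log_add_log hμ hν).lintegral_lt_top.ne
    (lintegral_mono fun p => neg_logKernel_toENNReal_le p.1 p.2)

theorem ae_ne_and_integrable_of_mem_measureClass (hμ : μ ∈ measureClass S) :
    (∀ᵐ p ∂(μ.prod μ), p.1 ≠ p.2) ∧
      Integrable (fun p : ℂ × ℂ => realKernel p.1 p.2) (μ.prod μ) := by
  obtain ⟨hfin, -, hlog, hen⟩ := hμ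
  obtain ⟨h1, h2⟩ := ae_coe_toReal_and_integrable_of_extIntegral_ne_top
    measurable_logKernel.aemeasurable (lintegral_neg_logKernel_ne_top hlog hlog) hen.ne
  have hne : ∀ᵐ p ∂(μ.prod μ), p.1 ≠ p.2 := by
    filter_upwards [h1] with p hp heq
    rw [heq, logKernel_self] at hp
    exact EReal.coe_ne_top _ hp.symm
  refine ⟨hne, h2.congr ?_⟩
  filter_upwards [hne] with p hp
  rw [logKernel_of_ne hp, EReal.toReal_coe]

theorem nullSingletonClass_of_mem_measureClass (hμ : μ ∈ measureClass S) : NullSingletonClass μ :=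
  have := hμ.1
  nullSingletonClass_of_ae_ne (ae_ne_and_integrable_of_mem_measureClass hμ).1

theorem mutualEnergy_eq_of_integrable [SFinite ν] [NullSingletonClass ν]
    (h : Integrable (fun p : ℂ × ℂ => realKernel p.1 p.2) (μ.prod ν)) :
    mutualEnergy μ ν = ((∫ p, realKernel p.1 p.2 ∂(μ.prod ν) : ℝ) : EReal) :=
  extIntegral_eq_coe_integral (ae_ne_of_nullSingletonClass.mono fun _ hp => logKernel_of_ne hp) h

theorem mem_measureClass_of_integrable [IsFiniteMeasure μ] [NullSingletonClass μ] (hS : μ.support ⊆ S)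
    (hlog : Integrable (fun t : ℂ => Real.log (1 + ‖t‖)) μ)
    (h : Integrable (fun p : ℂ × ℂ => realKernel p.1 p.2) (μ.prod μ)) : μ ∈ measureClass S :=
  ⟨‹_›, hS, hlog, by rw [mutualEnergy_eq_of_integrable h]; exact EReal.coe_lt_top _⟩

/-- Two measures of finite logarithmic energy have finite mutual energy. -/
theorem integrable_realKernel (hμ : μ ∈ measureClass S) (hν : ν ∈ measureClass T) :
    Integrable (fun p : ℂ × ℂ => realKernel p.1 p.2) (μ.prod ν) := by
  have := hμ.1
  have := hν.1
  have hLI := integrable_log_add_log hμ.2.2.1 hν.2.2.1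
  -- Layer cake for a single measure: `|x - y| < 2 exp (-s)` means `log 2 + realKernel x y > s` off
  -- the diagonal, so the factor `2` only shifts the kernel by a constant.
  have layer : ∀ {ρ : Measure ℂ} {U : Set ℂ}, ρ ∈ measureClass U →
      ∫⁻ s in Set.Ioi (0 : ℝ), ρ.prod ρ (nearDiagonal (2 * Real.exp (-s))) ≠ ⊤ := by
    intro ρ U hρ
    have := hρ.1
    obtain ⟨hne, hint⟩ := ae_ne_and_integrable_of_mem_measureClass hρ
    have hint' : Integrable (fun p : ℂ × ℂ => max 0 (Real.log 2 + realKernel p.1 p.2))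
        (ρ.prod ρ) := ((integrable_const _).add hint).pos_part.congr
          (ae_of_all _ fun p => max_comm _ _)
    have hL := lintegral_eq_lintegral_meas_lt (ρ.prod ρ)
      (f := fun p : ℂ × ℂ => max 0 (Real.log 2 + realKernel p.1 p.2))
      (ae_of_all _ fun p => le_max_left (0 : ℝ) _) hint'.aestronglyMeasurable.aemeasurable
    refine ne_top_of_le_ne_top hint'.lintegral_lt_top.ne ?_
    rw [hL]
    refine setLIntegral_mono' measurableSet_Ioi fun s hs => measure_mono_ae ?_
    filter_upwards [hne] with p hp hpd
    have hd : 0 < ‖p.1 - p.2‖ := norm_pos_iff.2 (sub_ne_zero.2 hp)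
    have hpd' : ‖p.1 - p.2‖ < 2 * Real.exp (-s) := by
      rw [← dist_eq_norm]; exact hpd
    have := Real.log_lt_log hd hpd'
    rw [Real.log_mul (by norm_num) (Real.exp_pos _).ne', Real.log_exp] at this
    refine lt_max_of_lt_right ?_
    rw [realKernel]
    linarith
  have hmeas : Measurable fun p : ℂ × ℂ => max 0 (realKernel p.1 p.2) :=
    measurable_const.max measurable_realKernel
  -- Layer cake for the mixed product: the level set at height `s` lies in the `exp
  -- (-s)`-neighbourhood of the diagonal, where `prod_nearDiagonal_le` reduces to the two
  -- self-products.
  have hpos : ∫⁻ p, ENNReal.ofReal (max 0 (realKernel p.1 p.2)) ∂(μ.prod ν) ≠ ⊤ := by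
    rw [lintegral_eq_lintegral_meas_lt (μ.prod ν)
      (f := fun p : ℂ × ℂ => max 0 (realKernel p.1 p.2)) (ae_of_all _ fun p => le_max_left (0 : ℝ) _)
      hmeas.aemeasurable]
    have hle : ∫⁻ s in Set.Ioi (0 : ℝ), μ.prod ν {p | s < max 0 (realKernel p.1 p.2)}
        ≤ ∫⁻ s in Set.Ioi (0 : ℝ), 4 * (μ.prod μ (nearDiagonal (2 * Real.exp (-s)))
          + ν.prod ν (nearDiagonal (2 * Real.exp (-s)))) := by
      refine setLIntegral_mono' measurableSet_Ioi fun s hs => ?_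
      refine le_trans (measure_mono fun p hp => ?_) (prod_nearDiagonal_le (Real.exp_pos _))
      have hs0 : (0 : ℝ) < s := hs
      have hp1 : s < -Real.log ‖p.1 - p.2‖ := (lt_max_iff.1 hp).resolve_left hs0.not_gt
      change dist p.1 p.2 < Real.exp (-s)
      rw [dist_eq_norm]
      rcases (norm_nonneg (p.1 - p.2)).eq_or_lt with h | h
      · rw [← h]; exact Real.exp_pos _
      · rw [← Real.exp_log h]; exact Real.exp_lt_exp.2 (by linarith)
    refine ne_top_of_le_ne_top ?_ hle
    rw [lintegral_const_mul' _ _ (by norm_num), lintegral_add_left]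
    · exact ENNReal.mul_ne_top (by norm_num) (ENNReal.add_ne_top.2 ⟨layer hμ, layer hν⟩)
    · refine Antitone.measurable fun s t hst => measure_mono fun p (hp : dist p.1 p.2 < _) => ?_
      refine lt_of_lt_of_le hp ?_
      gcongr
  have hposint : Integrable (fun p : ℂ × ℂ => max 0 (realKernel p.1 p.2)) (μ.prod ν) :=
    (lintegral_ofReal_ne_top_iff_integrable hmeas.aestronglyMeasurable
      (ae_of_all _ fun p => le_max_left (0 : ℝ) _)).1 hpos
  refine (hposint.add hLI).mono' measurable_realKernel.aestronglyMeasurable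
    (ae_of_all _ fun p => ?_)
  have h1 := neg_realKernel_le p.1 p.2
  have h2 := log_one_add_norm_nonneg p.1
  have h3 := log_one_add_norm_nonneg p.2
  rw [Real.norm_eq_abs, abs_le]
  constructor
  · have := le_max_left 0 (realKernel p.1 p.2)
    simp only [Pi.add_apply]
    linarith
  · have := le_max_right 0 (realKernel p.1 p.2)
    simp only [Pi.add_apply]
    linarith

/-- The product of a measure dominated by `c • μ` is dominated by `c²` times that of `μ`. This
admits restricted and rescaled measures as competitors. -/
theorem mem_measureClass_of_le_smul (hμ : μ ∈ measureClass S) {c : ℝ≥0∞} (hc : c ≠ ⊤)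
    (h : ν ≤ c • μ) : ν ∈ measureClass S := by
  have := hμ.1
  have := nullSingletonClass_of_mem_measureClass hμ
  have hac : ν ≪ μ := Measure.absolutelyContinuous_of_le_smul h
  have : IsFiniteMeasure ν := ⟨(h _).trans_lt (by
    simpa using ENNReal.mul_lt_top hc.lt_top (measure_lt_top μ _))⟩
  have : NullSingletonClass ν := ⟨fun x => hac (measure_singleton x)⟩
  refine mem_measureClass_of_integrable (hac.support_mono.trans hμ.2.1)
    (hμ.2.2.1.of_measure_le_smul hc h) ?_
  refine (ae_ne_and_integrable_of_mem_measureClass hμ).2.of_measure_le_smul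
    (ENNReal.mul_ne_top hc hc) ?_
  refine (Measure.prod_mono h h).trans_eq ?_
  rw [Measure.prod_smul_left, Measure.prod_smul_right, smul_smul]

theorem add_mem_measureClass (hμ : μ ∈ measureClass S) (hν : ν ∈ measureClass S) :
    μ + ν ∈ measureClass S := by
  have := hμ.1
  have := hν.1
  have := nullSingletonClass_of_mem_measureClass hμ
  have := nullSingletonClass_of_mem_measureClass hν
  have : NullSingletonClass (μ + ν) := ⟨fun x => by simp⟩
  refine mem_measureClass_of_integrable ?_ (hμ.2.2.1.add_measure hν.2.2.1) ?_
  · rw [Measure.support_add]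
    exact Set.union_subset hμ.2.1 hν.2.1
  · rw [Measure.prod_add, Measure.add_prod, Measure.add_prod]
    exact ((integrable_realKernel hμ hμ).add_measure (integrable_realKernel hν hμ)).add_measure
      ((integrable_realKernel hμ hν).add_measure (integrable_realKernel hν hν))

/-- The potential as a Bochner integral. -/
noncomputable def realPotential (ν : Measure ℂ) (z : ℂ) : ℝ := ∫ w, realKernel z w ∂ν

theorem integrable_realPotential (hμ : μ ∈ measureClass S) (hν : ν ∈ measureClass T) :
    Integrable (realPotential ν) μ := by
  have := hμ.1
  have := hν.1
  exact (integrable_realKernel hμ hν).integral_prod_left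

theorem ae_integrable_realKernel (hμ : μ ∈ measureClass S) (hν : ν ∈ measureClass T) :
    ∀ᵐ z ∂μ, Integrable (realKernel z) ν := by
  have := hν.1
  have := hμ.1
  exact (integrable_realKernel hμ hν).prod_right_ae

theorem ae_potential_eq (hμ : μ ∈ measureClass S) (hν : ν ∈ measureClass T) :
    ∀ᵐ z ∂μ, potential ν z = realPotential ν z := by
  have := nullSingletonClass_of_mem_measureClass hν
  filter_upwards [ae_integrable_realKernel hμ hν] with z hz
  refine extIntegral_eq_coe_integral ?_ hz
  have : ∀ᵐ w ∂ν, w ≠ z := by simp [ae_iff]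
  filter_upwards [this] with w hw
  exact logKernel_of_ne hw.symm

theorem mutualEnergy_eq_coe_integral (hμ : μ ∈ measureClass S) (hν : ν ∈ measureClass T) :
    mutualEnergy μ ν = ((∫ z, realPotential ν z ∂μ : ℝ) : EReal) := by
  have := hμ.1
  have := hν.1
  have := nullSingletonClass_of_mem_measureClass hν
  rw [mutualEnergy_eq_of_integrable (integrable_realKernel hμ hν),
    integral_prod _ (integrable_realKernel hμ hν)]
  rfl

theorem integral_realPotential_comm (hμ : μ ∈ measureClass S) (hν : ν ∈ measureClass T) :
    ∫ z, realPotential ν z ∂μ = ∫ z, realPotential μ z ∂ν := by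
  have := hμ.1
  have := hν.1
  have := integral_integral_swap (f := realKernel) (integrable_realKernel hμ hν)
  simp only [realPotential]
  rw [this]
  simp only [realKernel_comm]

end MeasureClass

/-! ### Admissible external fields. -/

section Admissible

variable {S : Set ℂ} {f : ℂ → EReal} {μ : Measure ℂ}

theorem Admissible.mul_log_le (hf : Admissible S f) (L : ℝ) :
    ∃ R : ℝ, 1 < R ∧ ∀ x ∈ S, R ≤ ‖x‖ → ((L * Real.log ‖x‖ : ℝ) : EReal) ≤ f x := by
  have h := hf.growth.eventually (lt_mem_nhds (EReal.coe_lt_top L))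
  rw [eventually_inf_principal, hasBasis_cobounded_norm.eventually_iff] at h
  obtain ⟨R, -, hR⟩ := h
  refine ⟨max R 2, lt_max_of_lt_right one_lt_two, fun x hx hxR => ?_⟩
  have hlog : 0 < Real.log ‖x‖ :=
    Real.log_pos (lt_of_lt_of_le one_lt_two ((le_max_right _ _).trans hxR))
  have hlt := (hR ((le_max_left _ _).trans hxR) hx).le
  rw [EReal.le_div_iff_mul_le (by exact_mod_cast hlog) (EReal.coe_ne_top _)] at hlt
  rwa [EReal.coe_mul]

/-- Lower semicontinuity gives a minimum on the part of `S` in a closed disc; growth gives the bound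
`0` outside it. -/
theorem Admissible.exists_coe_le (hS : IsClosed S) (hf : Admissible S f) :
    ∃ c : ℝ, ∀ x ∈ S, (c : EReal) ≤ f x := by
  obtain ⟨R, -, hR⟩ := hf.mul_log_le 0
  rcases (S ∩ Metric.closedBall 0 R).eq_empty_or_nonempty with he | hne
  · refine ⟨0, fun x hx => ?_⟩
    have hxR : R ≤ ‖x‖ := by
      by_contra! hlt
      have : x ∈ S ∩ Metric.closedBall 0 R := ⟨hx, by simpa using hlt.le⟩
      rw [he] at this
      exact this
    simpa using hR x hx hxR
  · obtain ⟨a, ha, hmin⟩ := LowerSemicontinuousOn.exists_isMinOn hne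
      ((isCompact_closedBall (0 : ℂ) R).inter_left hS)
      (hf.lowerSemicontinuousOn.mono Set.inter_subset_left)
    obtain ⟨c, hc⟩ : ∃ c : ℝ, (c : EReal) ≤ f a := by
      have := hf.ne_bot a ha.1
      induction h : f a with
      | bot => exact absurd h this
      | coe r => exact ⟨r, le_rfl⟩
      | top => exact ⟨0, le_top⟩
    refine ⟨min c 0, fun x hx => ?_⟩
    rcases le_or_gt ‖x‖ R with h | h
    · refine le_trans ?_ (hc.trans (hmin ⟨hx, by simpa using h⟩))
      exact_mod_cast min_le_left _ _
    · refine le_trans ?_ (hR x hx h.le)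
      rw [zero_mul]
      exact_mod_cast min_le_right _ _

theorem Admissible.aemeasurable (hS : IsClosed S) (hf : Admissible S f)
    (hμ : ∀ᵐ x ∂μ, x ∈ S) : AEMeasurable f μ := by
  rw [← Measure.restrict_eq_self_of_ae_mem hμ]
  refine aemeasurable_restrict_of_measurable_subtype hS.measurableSet ?_
  refine measurable_of_Iic fun y => ?_
  exact (((lowerSemicontinuous_restrict_iff.2 hf.lowerSemicontinuousOn).isClosed_preimage
    y)).measurableSet

theorem Admissible.lintegral_neg_ne_top [IsFiniteMeasure μ] (hS : IsClosed S)
    (hf : Admissible S f) (hμ : ∀ᵐ x ∂μ, x ∈ S) : ∫⁻ x, (-f x).toENNReal ∂μ ≠ ⊤ := by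
  obtain ⟨c, hc⟩ := hf.exists_coe_le hS
  refine ne_top_of_le_ne_top (b := ∫⁻ _, ENNReal.ofReal (-c) ∂μ) ?_ (lintegral_mono_ae ?_)
  · rw [lintegral_const]
    exact ENNReal.mul_ne_top ENNReal.ofReal_ne_top (measure_ne_top _ _)
  · filter_upwards [hμ] with x hx
    rw [← EReal.real_coe_toENNReal, EReal.coe_neg]
    exact EReal.toENNReal_le_toENNReal (EReal.neg_le_neg_iff.2 (hc x hx))

theorem integrable_log_of_ae_mem_compact [IsFiniteMeasure μ] {A : Set ℂ} (hA : IsCompact A)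
    (hμ : ∀ᵐ x ∂μ, x ∈ A) : Integrable (fun t : ℂ => Real.log (1 + ‖t‖)) μ := by
  obtain ⟨R, hR⟩ := hA.isBounded.exists_norm_le
  have hm : Measurable fun t : ℂ => Real.log (1 + ‖t‖) := by fun_prop
  refine Integrable.of_bound hm.aestronglyMeasurable (Real.log (1 + R)) ?_
  filter_upwards [hμ] with x hx
  rw [Real.norm_eq_abs, abs_of_nonneg (log_one_add_norm_nonneg x)]
  exact Real.log_le_log (by positivity) (by linarith [hR x hx])

/-- A measure of the class has any prescribed mass and integrates the external field. -/
theorem Admissible.exists_measure (hS : IsClosed S) (hf : Admissible S f) {m : ℝ≥0∞}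
    (hm : m ≠ ⊤) : ∃ ν ∈ measureClass S, ν Set.univ = m ∧ extIntegral ν f ≠ ⊤ := by
  obtain ⟨σ, hσ⟩ := lt_iSup_iff.1 hf.finite_on_pos_capacity
  obtain ⟨hprob, hσ⟩ := lt_iSup_iff.1 hσ
  obtain ⟨hcpt, hσ⟩ := lt_iSup_iff.1 hσ
  obtain ⟨hsub, hσ⟩ := lt_iSup_iff.1 hσ
  have hsupp : ∀ᵐ x ∂σ, x ∈ σ.support := Measure.support_mem_ae
  have hσS : σ ∈ measureClass S := by
    refine ⟨inferInstance, hsub.trans fun x hx => hx.1,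
      integrable_log_of_ae_mem_compact hcpt hsupp, ?_⟩
    rw [EReal.zero_lt_exp_iff] at hσ
    rw [lt_top_iff_ne_top]
    intro h
    simp [h] at hσ
  -- The sublevel sets `{f ≤ n}` exhaust `{f < ⊤}`, which carries `σ`, so one of them has positive
  -- mass. Restricting `σ` to it and rescaling gives the required measure.
  obtain ⟨n, hn⟩ : ∃ n : ℕ, σ {x | x ∈ S ∧ f x ≤ ((n : ℝ) : EReal)} ≠ 0 := by
    by_contra! hall
    have h0 := measure_iUnion_null_iff.2 hall
    have h1 : ∀ᵐ x ∂σ, x ∈ ⋃ n : ℕ, {x | x ∈ S ∧ f x ≤ ((n : ℝ) : EReal)} := by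
      filter_upwards [hsupp] with x hx
      obtain ⟨hxS, hxf⟩ := hsub hx
      obtain ⟨r, hr⟩ := EReal.lt_iff_exists_real_btwn.1 hxf
      obtain ⟨n, hn⟩ := exists_nat_ge r
      refine Set.mem_iUnion.2 ⟨n, hxS, hr.1.le.trans ?_⟩
      exact_mod_cast hn
    have h2 : ∀ᵐ x ∂σ, x ∉ ⋃ n : ℕ, {x | x ∈ S ∧ f x ≤ ((n : ℝ) : EReal)} :=
      measure_eq_zero_iff_ae_notMem.1 h0
    obtain ⟨x, hx⟩ := (h1.and h2).exists
    exact hx.2 hx.1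
  set A := {x | x ∈ S ∧ f x ≤ ((n : ℝ) : EReal)} with hA
  have hAm : MeasurableSet A := by
    obtain ⟨v, hv, hSv⟩ := lowerSemicontinuousOn_iff_preimage_Iic.1 hf.lowerSemicontinuousOn
      ((n : ℝ) : EReal)
    have : A = S ∩ v := hSv
    rw [this]
    exact (hS.inter hv).measurableSet
  have hc : m / σ A ≠ ⊤ := ENNReal.div_ne_top hm hn
  have hle : (m / σ A) • σ.restrict A ≤ (m / σ A) • σ := by
    gcongr
    exact Measure.restrict_le_self
  have hν := mem_measureClass_of_le_smul hσS hc hle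
  refine ⟨_, hν, ?_, ?_⟩
  · rw [Measure.smul_apply, Measure.restrict_apply_univ, smul_eq_mul,
      ENNReal.div_mul_cancel hn (measure_ne_top _ _)]
  · have := hν.1
    have hAae : ∀ᵐ x ∂((m / σ A) • σ.restrict A), x ∈ A :=
      Measure.ae_smul_measure (ae_restrict_mem hAm) _
    have hpos : ∫⁻ x, (f x).toENNReal ∂((m / σ A) • σ.restrict A) ≠ ⊤ := by
      refine ne_top_of_le_ne_top
        (b := ∫⁻ _, ENNReal.ofReal n ∂((m / σ A) • σ.restrict A)) ?_ (lintegral_mono_ae ?_)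
      · rw [lintegral_const]
        exact ENNReal.mul_ne_top ENNReal.ofReal_ne_top (measure_ne_top _ _)
      · filter_upwards [hAae] with x hx
        rw [← EReal.real_coe_toENNReal]
        exact EReal.toENNReal_le_toENNReal hx.2
    have hneg := hf.lintegral_neg_ne_top hS (hAae.mono fun x hx => hx.1)
    rw [extIntegral, ← EReal.coe_ennreal_toReal hpos, ← EReal.coe_ennreal_toReal hneg,
      ← EReal.coe_sub]
    exact EReal.coe_ne_top _

end Admissible

/-! ### Real-valued energies and finiteness of the field integrals at a solution. -/

section Energy

variable {d : ℕ} {Δ : Fin d → Set ℂ} {C : Matrix (Fin d) (Fin d) ℝ} {K : Set (Fin d → ℝ)}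
  {Q : Fin d → ℂ → EReal} {μ : Fin d → Measure ℂ}

theorem coe_sum_ereal {ι : Type*} (s : Finset ι) (g : ι → ℝ) :
    ((∑ i ∈ s, g i : ℝ) : EReal) = ∑ i ∈ s, (g i : EReal) := by
  classical
  induction s using Finset.induction_on with
  | empty => simp
  | insert a s ha ih => rw [Finset.sum_insert ha, Finset.sum_insert ha, EReal.coe_add, ih]

theorem ereal_sum_ne_bot {ι : Type*} (s : Finset ι) {g : ι → EReal} (h : ∀ i, g i ≠ ⊥) :
    ∑ i ∈ s, g i ≠ ⊥ := by
  classical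
  induction s using Finset.induction_on with
  | empty => simp
  | insert a s ha ih =>
    rw [Finset.sum_insert ha, Ne, EReal.add_eq_bot_iff, not_or]
    exact ⟨h a, ih⟩

theorem ereal_ne_top_of_sum_ne_top {ι : Type*} {s : Finset ι} {g : ι → EReal}
    (h : ∀ i, g i ≠ ⊥) (hs : ∑ i ∈ s, g i ≠ ⊤) {i : ι} (hi : i ∈ s) : g i ≠ ⊤ := by
  classical
  intro htop
  rw [← Finset.add_sum_erase s g hi, htop,
    EReal.top_add_of_ne_bot (ereal_sum_ne_bot _ h)] at hs
  exact hs rfl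

/-- The mutual energy as a real number. -/
noncomputable def realMutualEnergy (μ ν : Measure ℂ) : ℝ := ∫ z, realPotential ν z ∂μ

/-- The weighted energy as a real number. -/
noncomputable def realWeightedEnergy (C : Matrix (Fin d) (Fin d) ℝ) (Q : Fin d → ℂ → EReal)
    (μ : Fin d → Measure ℂ) : ℝ :=
  ∑ i, ∑ j, C i j * realMutualEnergy (μ i) (μ j) + 2 * ∑ j, ∫ z, (Q j z).toReal ∂(μ j)

/-- The field `f` has a finite integral with respect to `μ`. -/
def FiniteField (f : ℂ → EReal) (μ : Measure ℂ) : Prop :=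
  (∀ᵐ x ∂μ, f x = ((f x).toReal : EReal)) ∧ Integrable (fun x => (f x).toReal) μ

theorem energy_eq_coe (hμ : ∀ i, μ i ∈ measureClass (Δ i)) :
    energy C μ = ((∑ i, ∑ j, C i j * realMutualEnergy (μ i) (μ j) : ℝ) : EReal) := by
  simp only [energy, coe_sum_ereal, EReal.coe_mul, mutualEnergy_eq_coe_integral (hμ _) (hμ _),
    realMutualEnergy]

theorem weightedEnergy_eq_coe (hμ : ∀ i, μ i ∈ measureClass (Δ i))
    (hQ : ∀ i, FiniteField (Q i) (μ i)) :
    weightedEnergy C Q μ = (realWeightedEnergy C Q μ : EReal) := by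
  rw [weightedEnergy, energy_eq_coe hμ, realWeightedEnergy, EReal.coe_add, EReal.coe_mul,
    coe_sum_ereal Finset.univ fun j => ∫ z, (Q j z).toReal ∂(μ j)]
  simp only [extIntegral_eq_coe_integral (hQ _).1 (hQ _).2]
  rfl

theorem ae_mem_of_mem_measureClass {S : Set ℂ} {ν : Measure ℂ} (hν : ν ∈ measureClass S) :
    ∀ᵐ x ∂ν, x ∈ S :=
  mem_of_superset Measure.support_mem_ae hν.2.1

theorem finiteField_of_extIntegral_ne_top {S : Set ℂ} {f : ℂ → EReal} {ν : Measure ℂ}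
    (hS : IsClosed S) (hf : Admissible S f) (hν : ν ∈ measureClass S)
    (h : extIntegral ν f ≠ ⊤) : FiniteField f ν :=
  have := hν.1
  have hae := ae_mem_of_mem_measureClass hν
  ae_coe_toReal_and_integrable_of_extIntegral_ne_top (hf.aemeasurable hS hae)
    (hf.lintegral_neg_ne_top hS hae) h

/-- Compare with a tuple of the same masses and finite field integrals. The interaction energy of
`μ` is finite and no field integral is `⊥`, so a single infinite field integral would make the
energy of `μ` exceed the competitor's. -/
theorem IsSolution.finiteField (hΔ : ∀ i, IsClosed (Δ i)) (hQ : ∀ i, Admissible (Δ i) (Q i))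
    (hμ : IsSolution C Δ K Q μ) (i : Fin d) : FiniteField (Q i) (μ i) := by
  have hfin := fun j => (hμ.1.1 j).1
  choose ν hν hmass hν_top using fun j =>
    (hQ j).exists_measure (hΔ j) (measure_ne_top (μ j) Set.univ)
  have hνK : ν ∈ tupleClass Δ K := by
    refine ⟨hν, ?_⟩
    have : (fun j => (ν j).real Set.univ) = fun j => (μ j).real Set.univ := by
      ext j
      rw [measureReal_def, measureReal_def, hmass]
    rw [this]
    exact hμ.1.2
  have hle : weightedEnergy C Q μ ≤ weightedEnergy C Q ν := by
    rw [hμ.2]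
    exact iInf₂_le ν hνK
  rw [weightedEnergy_eq_coe hν fun j => finiteField_of_extIntegral_ne_top (hΔ j) (hQ j) (hν j)
    (hν_top j), weightedEnergy, energy_eq_coe hμ.1.1] at hle
  refine finiteField_of_extIntegral_ne_top (hΔ i) (hQ i) (hμ.1.1 i) ?_
  refine ereal_ne_top_of_sum_ne_top (s := Finset.univ) (g := fun j => extIntegral (μ j) (Q j))
    (fun j => ?_) ?_ (Finset.mem_univ i)
  · exact extIntegral_ne_bot
      ((hQ j).lintegral_neg_ne_top (hΔ j) (ae_mem_of_mem_measureClass (hμ.1.1 j)))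
  · intro htop
    rw [htop, EReal.mul_top_of_pos (by norm_num), EReal.coe_add_top, top_le_iff] at hle
    exact EReal.coe_ne_top _ hle

theorem IsSolution.realWeightedEnergy_le (hΔ : ∀ i, IsClosed (Δ i))
    (hQ : ∀ i, Admissible (Δ i) (Q i)) (hμ : IsSolution C Δ K Q μ) {ν : Fin d → Measure ℂ}
    (hν : ν ∈ tupleClass Δ K) (hνQ : ∀ i, FiniteField (Q i) (ν i)) :
    realWeightedEnergy C Q μ ≤ realWeightedEnergy C Q ν := by
  rw [← EReal.coe_le_coe_iff, ← weightedEnergy_eq_coe hν.1 hνQ,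
    ← weightedEnergy_eq_coe hμ.1.1 (hμ.finiteField hΔ hQ), hμ.2]
  exact iInf₂_le ν hν

end Energy

/-! ### Bilinearity along segments of measures. -/

section Variation

variable {S T : Set ℂ} {μ ν ρ : Measure ℂ}

theorem smul_mem_measureClass (hμ : μ ∈ measureClass S) {c : ℝ≥0∞} (hc : c ≠ ⊤) :
    c • μ ∈ measureClass S :=
  mem_measureClass_of_le_smul hμ hc le_rfl

theorem realMutualEnergy_comm (hμ : μ ∈ measureClass S) (hν : ν ∈ measureClass T) :
    realMutualEnergy μ ν = realMutualEnergy ν μ :=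
  integral_realPotential_comm hμ hν

theorem realMutualEnergy_combination_left (hμ : μ ∈ measureClass S) (hν : ν ∈ measureClass S)
    (hρ : ρ ∈ measureClass T) {a b : ℝ} (ha : 0 ≤ a) (hb : 0 ≤ b) :
    realMutualEnergy (ENNReal.ofReal a • μ + ENNReal.ofReal b • ν) ρ
      = a * realMutualEnergy μ ρ + b * realMutualEnergy ν ρ := by
  rw [realMutualEnergy, integral_add_measure
    ((integrable_realPotential hμ hρ).smul_measure ENNReal.ofReal_ne_top)
    ((integrable_realPotential hν hρ).smul_measure ENNReal.ofReal_ne_top),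
    integral_smul_measure, integral_smul_measure, ENNReal.toReal_ofReal ha,
    ENNReal.toReal_ofReal hb]
  rfl

theorem realMutualEnergy_combination_right (hμ : μ ∈ measureClass S) (hν : ν ∈ measureClass S)
    (hρ : ρ ∈ measureClass T) {a b : ℝ} (ha : 0 ≤ a) (hb : 0 ≤ b) :
    realMutualEnergy ρ (ENNReal.ofReal a • μ + ENNReal.ofReal b • ν)
      = a * realMutualEnergy ρ μ + b * realMutualEnergy ρ ν := by
  have hmem := add_mem_measureClass (smul_mem_measureClass hμ (ENNReal.ofReal_ne_top (r := a)))
    (smul_mem_measureClass hν (ENNReal.ofReal_ne_top (r := b)))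
  rw [realMutualEnergy_comm hρ hmem, realMutualEnergy_combination_left hμ hν hρ ha hb,
    realMutualEnergy_comm hρ hμ, realMutualEnergy_comm hρ hν]

theorem FiniteField.combination {f : ℂ → EReal} (hμ : FiniteField f μ) (hν : FiniteField f ν)
    (a b : ℝ) : FiniteField f (ENNReal.ofReal a • μ + ENNReal.ofReal b • ν) :=
  ⟨ae_add_measure_iff.2 ⟨Measure.ae_smul_measure hμ.1 _, Measure.ae_smul_measure hν.1 _⟩,
    (hμ.2.smul_measure ENNReal.ofReal_ne_top).add_measure
      (hν.2.smul_measure ENNReal.ofReal_ne_top)⟩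

theorem integral_combination {g : ℂ → ℝ} (hμ : Integrable g μ) (hν : Integrable g ν)
    {a b : ℝ} (ha : 0 ≤ a) (hb : 0 ≤ b) :
    ∫ x, g x ∂(ENNReal.ofReal a • μ + ENNReal.ofReal b • ν)
      = a * ∫ x, g x ∂μ + b * ∫ x, g x ∂ν := by
  rw [integral_add_measure (hμ.smul_measure ENNReal.ofReal_ne_top)
    (hν.smul_measure ENNReal.ofReal_ne_top),
    integral_smul_measure, integral_smul_measure, ENNReal.toReal_ofReal ha,
    ENNReal.toReal_ofReal hb, smul_eq_mul, smul_eq_mul]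

theorem nonneg_of_forall_quadratic_nonneg {L q : ℝ}
    (h : ∀ t : ℝ, 0 < t → t ≤ 1 → 0 ≤ 2 * t * L + t ^ 2 * q) : 0 ≤ L := by
  by_contra! hL
  have hq : 0 < 1 + |q| := by positivity
  -- If `L < 0`, this `t` satisfies `t * q ≤ -L`, so that `2 * L + t * q ≤ L < 0`.
  set t : ℝ := min 1 (-L / (1 + |q|)) with ht
  have ht0 : 0 < t := lt_min one_pos (div_pos (neg_pos.2 hL) hq)
  have ht1 : t * (1 + |q|) ≤ -L := by
    rw [← le_div_iff₀ hq]
    exact min_le_right _ _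
  have h1 := h t ht0 (min_le_left _ _)
  have h2 : 0 ≤ t * (2 * L + t * q) := by nlinarith
  have h3 := nonneg_of_mul_nonneg_right h2 ht0
  nlinarith [le_abs_self q, mul_le_mul_of_nonneg_left (le_abs_self q) ht0.le]

end Variation

/-! ### First variation and the Euler–Lagrange inequality. -/

section EulerLagrange

variable {d : ℕ} {Δ : Fin d → Set ℂ} {C : Matrix (Fin d) (Fin d) ℝ} {K : Set (Fin d → ℝ)}
  {Q : Fin d → ℂ → EReal} {μ : Fin d → Measure ℂ}

/-- Bookkeeping for a change of the `i`-th component alone by `s (ν - μ i)`: `D l` plays the role of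
`I(ν - μ i, μ l)` and `g` of `I(ν - μ i)`. Symmetry of `C` merges the row and column contributions.
-/
theorem sum_sum_update_sub {e e' : Fin d → Fin d → ℝ} {i : Fin d} {D : Fin d → ℝ} {s g : ℝ}
    (hC : ∀ k l, C k l = C l k)
    (he : ∀ k l, e' k l = e k l + s * ((if k = i then D l else 0) + if l = i then D k else 0)
      + s ^ 2 * (if k = i then if l = i then g else 0 else 0)) :
    ∑ k, ∑ l, C k l * e' k l
      = ∑ k, ∑ l, C k l * e k l + 2 * s * ∑ l, C i l * D l + s ^ 2 * (C i i * g) := by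
  have h1 : ∑ k, ∑ l, C k l * (if k = i then D l else 0) = ∑ l, C i l * D l := by
    rw [Finset.sum_comm]
    simp
  have h2 : ∑ k, ∑ l, C k l * (if l = i then D k else 0) = ∑ l, C i l * D l := by
    simp [hC _ i]
  have h3 : ∑ k, ∑ l, C k l * (if k = i then if l = i then g else 0 else 0) = C i i * g := by
    rw [Finset.sum_comm]
    simp
  have h4 : ∀ k l, C k l * e' k l = C k l * e k l
      + s * (C k l * (if k = i then D l else 0)) + s * (C k l * (if l = i then D k else 0))
      + s ^ 2 * (C k l * (if k = i then if l = i then g else 0 else 0)) := by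
    intro k l
    rw [he]
    ring
  simp only [h4, Finset.sum_add_distrib, ← Finset.mul_sum, h1, h2, h3]
  ring

theorem realWeightedEnergy_update (hC : ∀ k l, C k l = C l k)
    (hμ : ∀ i, μ i ∈ measureClass (Δ i)) (hQ : ∀ i, FiniteField (Q i) (μ i)) {i : Fin d}
    {ν : Measure ℂ} (hν : ν ∈ measureClass (Δ i)) (hνQ : FiniteField (Q i) ν) {t : ℝ}
    (ht0 : 0 ≤ t) (ht1 : t ≤ 1) :
    realWeightedEnergy C Q
        (Function.update μ i (ENNReal.ofReal (1 - t) • μ i + ENNReal.ofReal t • ν))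
      = realWeightedEnergy C Q μ
        + 2 * t * (∑ l, C i l * (realMutualEnergy ν (μ l) - realMutualEnergy (μ i) (μ l))
          + (∫ z, (Q i z).toReal ∂ν - ∫ z, (Q i z).toReal ∂(μ i)))
        + t ^ 2 * (C i i * (realMutualEnergy ν ν - 2 * realMutualEnergy ν (μ i)
          + realMutualEnergy (μ i) (μ i))) := by
  set ρ := ENNReal.ofReal (1 - t) • μ i + ENNReal.ofReal t • ν with hρdef
  have hs : 0 ≤ 1 - t := sub_nonneg.2 ht1
  have hρ : ρ ∈ measureClass (Δ i) := add_mem_measureClass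
    (smul_mem_measureClass (hμ i) ENNReal.ofReal_ne_top)
    (smul_mem_measureClass hν ENNReal.ofReal_ne_top)
  have hsumQ : ∑ j, ∫ z, (Q j z).toReal ∂(Function.update μ i ρ j)
      = ∑ j, ∫ z, (Q j z).toReal ∂(μ j)
        + t * (∫ z, (Q i z).toReal ∂ν - ∫ z, (Q i z).toReal ∂(μ i)) := by
    rw [← Finset.add_sum_erase _ _ (Finset.mem_univ i),
      ← Finset.add_sum_erase Finset.univ (fun j => ∫ z, (Q j z).toReal ∂(μ j))
        (Finset.mem_univ i), Function.update_self,
      integral_combination (hQ i).2 hνQ.2 hs ht0]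
    have : ∀ j ∈ Finset.univ.erase i, ∫ z, (Q j z).toReal ∂(Function.update μ i ρ j)
        = ∫ z, (Q j z).toReal ∂(μ j) := fun j hj => by
      rw [Function.update_of_ne (Finset.ne_of_mem_erase hj)]
    rw [Finset.sum_congr rfl this]
    ring
  have hsumC := sum_sum_update_sub (C := C)
    (e := fun k l => realMutualEnergy (μ k) (μ l))
    (e' := fun k l => realMutualEnergy (Function.update μ i ρ k) (Function.update μ i ρ l))
    (i := i) (D := fun l => realMutualEnergy ν (μ l) - realMutualEnergy (μ i) (μ l)) (s := t)
    (g := realMutualEnergy ν ν - 2 * realMutualEnergy ν (μ i) + realMutualEnergy (μ i) (μ i))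
    hC (by
      intro k l
      rcases eq_or_ne k i with rfl | hk
      · rcases eq_or_ne l k with rfl | hl
        · simp only [Function.update_self, if_true]
          rw [realMutualEnergy_combination_left (hμ l) hν hρ hs ht0,
            realMutualEnergy_combination_right (hμ l) hν (hμ l) hs ht0,
            realMutualEnergy_combination_right (hμ l) hν hν hs ht0,
            realMutualEnergy_comm (hμ l) hν]
          ring
        · simp only [Function.update_self, Function.update_of_ne hl, if_true, if_neg hl]
          rw [realMutualEnergy_combination_left (hμ k) hν (hμ l) hs ht0]
          ring
      · rcases eq_or_ne l i with rfl | hl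
        · simp only [Function.update_self, Function.update_of_ne hk, if_true, if_neg hk]
          rw [realMutualEnergy_combination_right (hμ l) hν (hμ k) hs ht0,
            realMutualEnergy_comm (hμ k) hν, realMutualEnergy_comm (hμ k) (hμ l)]
          ring
        · simp only [Function.update_of_ne hk, Function.update_of_ne hl, if_neg hk, if_neg hl]
          ring)
  rw [realWeightedEnergy, hsumC, hsumQ, realWeightedEnergy]
  ring

/-- The total potential acting on the `i`-th component. -/
noncomputable def totalPotential (C : Matrix (Fin d) (Fin d) ℝ) (Q : Fin d → ℂ → EReal)
    (μ : Fin d → Measure ℂ) (i : Fin d) (z : ℂ) : ℝ :=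
  ∑ l, C i l * realPotential (μ l) z + (Q i z).toReal

theorem integrable_sum_realPotential (hμ : ∀ i, μ i ∈ measureClass (Δ i)) {S : Set ℂ}
    {ν : Measure ℂ} (hν : ν ∈ measureClass S) (i : Fin d) :
    Integrable (fun z => ∑ l, C i l * realPotential (μ l) z) ν :=
  integrable_finsetSum _ fun l _ => (integrable_realPotential hν (hμ l)).const_mul _

theorem integrable_totalPotential (hμ : ∀ i, μ i ∈ measureClass (Δ i)) {i : Fin d} {S : Set ℂ}
    {ν : Measure ℂ} (hν : ν ∈ measureClass S) (hνQ : FiniteField (Q i) ν) :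
    Integrable (totalPotential C Q μ i) ν :=
  (integrable_sum_realPotential hμ hν i).add hνQ.2

theorem integral_totalPotential (hμ : ∀ i, μ i ∈ measureClass (Δ i)) {i : Fin d} {S : Set ℂ}
    {ν : Measure ℂ} (hν : ν ∈ measureClass S) (hνQ : FiniteField (Q i) ν) :
    ∫ z, totalPotential C Q μ i z ∂ν
      = ∑ l, C i l * realMutualEnergy ν (μ l) + ∫ z, (Q i z).toReal ∂ν := by
  simp only [totalPotential]
  rw [integral_add (integrable_sum_realPotential hμ hν i) hνQ.2,
    integral_finsetSum _ fun l _ => (integrable_realPotential hν (hμ l)).const_mul _]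
  simp only [integral_const_mul, realMutualEnergy]

/-- Equal mass keeps the whole segment from `μ i` to `ν` admissible; the claim is that the
derivative of the energy at `t = 0` is nonnegative. -/
theorem IsSolution.integral_totalPotential_le (hΔ : ∀ i, IsClosed (Δ i))
    (hC : ∀ k l, C k l = C l k) (hQ : ∀ i, Admissible (Δ i) (Q i))
    (hμ : IsSolution C Δ K Q μ) {i : Fin d} {ν : Measure ℂ} (hν : ν ∈ measureClass (Δ i))
    (hνQ : FiniteField (Q i) ν) (hmass : ν Set.univ = μ i Set.univ) :
    ∫ z, totalPotential C Q μ i z ∂(μ i) ≤ ∫ z, totalPotential C Q μ i z ∂ν := by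
  have hμQ := hμ.finiteField hΔ hQ
  have key : 0 ≤ ∑ l, C i l * (realMutualEnergy ν (μ l) - realMutualEnergy (μ i) (μ l))
      + (∫ z, (Q i z).toReal ∂ν - ∫ z, (Q i z).toReal ∂(μ i)) := by
    refine nonneg_of_forall_quadratic_nonneg (q := C i i * (realMutualEnergy ν ν
      - 2 * realMutualEnergy ν (μ i) + realMutualEnergy (μ i) (μ i))) fun t ht0 ht1 => ?_
    have hmem : Function.update μ i (ENNReal.ofReal (1 - t) • μ i + ENNReal.ofReal t • ν)
        ∈ tupleClass Δ K := by
      constructor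
      · intro k
        rcases eq_or_ne k i with rfl | hk
        · rw [Function.update_self]
          exact add_mem_measureClass (smul_mem_measureClass (hμ.1.1 k) ENNReal.ofReal_ne_top)
            (smul_mem_measureClass hν ENNReal.ofReal_ne_top)
        · rw [Function.update_of_ne hk]
          exact hμ.1.1 k
      · convert hμ.1.2 using 1
        ext k
        rcases eq_or_ne k i with rfl | hk
        · rw [Function.update_self, measureReal_def, measureReal_def, Measure.add_apply,
            Measure.smul_apply, Measure.smul_apply, hmass, smul_eq_mul, smul_eq_mul, ← add_mul,
            ← ENNReal.ofReal_add (sub_nonneg.2 ht1) ht0.le]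
          simp
        · rw [Function.update_of_ne hk]
    have hfin : ∀ k, FiniteField (Q k)
        (Function.update μ i (ENNReal.ofReal (1 - t) • μ i + ENNReal.ofReal t • ν) k) := by
      intro k
      rcases eq_or_ne k i with rfl | hk
      · rw [Function.update_self]
        exact (hμQ k).combination hνQ _ _
      · rw [Function.update_of_ne hk]
        exact hμQ k
    have hle := hμ.realWeightedEnergy_le hΔ hQ hmem hfin
    rw [realWeightedEnergy_update hC hμ.1.1 hμQ hν hνQ ht0.le ht1] at hle
    linarith
  rw [integral_totalPotential hμ.1.1 (hμ.1.1 i) (hμQ i), integral_totalPotential hμ.1.1 hν hνQ]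
  simp only [mul_sub, Finset.sum_sub_distrib] at key
  linarith

/-- The total potential is almost everywhere bounded above on the support of a solution. -/
theorem IsSolution.exists_ae_totalPotential_le (hΔ : ∀ i, IsClosed (Δ i))
    (hC : ∀ k l, C k l = C l k) (hQ : ∀ i, Admissible (Δ i) (Q i))
    (hμ : IsSolution C Δ K Q μ) (i : Fin d) :
    ∃ F : ℝ, ∀ᵐ z ∂(μ i), totalPotential C Q μ i z ≤ F := by
  have := (hμ.1.1 i).1
  have hμQ := hμ.finiteField hΔ hQ i
  have hint := integrable_totalPotential (C := C) hμ.1.1 (hμ.1.1 i) hμQ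
  set h := totalPotential C Q μ i with hh
  rcases eq_or_ne (μ i) 0 with h0 | h0
  · exact ⟨0, by simp [h0]⟩
  have hm : 0 < (μ i).real Set.univ := by
    rw [measureReal_def, ENNReal.toReal_pos_iff]
    exact ⟨Measure.measure_univ_pos.2 h0, measure_lt_top _ _⟩
  -- The bound is the mean of `h`; it suffices that the mean over any `B` does not exceed it.
  refine ⟨(∫ z, h z ∂(μ i)) / (μ i).real Set.univ,
    ae_le_of_forall_setIntegral_le hint (integrable_const _) fun B hB _ => ?_⟩
  rw [setIntegral_const, smul_eq_mul, mul_div_assoc', le_div_iff₀ hm]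
  have hsplit := integral_add_compl hB hint
  have hmsplit : (μ i).real B + (μ i).real Bᶜ = (μ i).real Set.univ :=
    measureReal_add_measureReal_compl hB
  rcases eq_or_ne ((μ i) Bᶜ) 0 with hBc | hBc
  · have h1 : ∫ z in Bᶜ, h z ∂(μ i) = 0 := by
      rw [Measure.restrict_eq_zero.2 hBc, integral_zero_measure]
    have h2 : (μ i).real Bᶜ = 0 := by rw [measureReal_def, hBc, ENNReal.toReal_zero]
    rw [← hsplit, ← hmsplit, h1, h2]
    apply le_of_eq
    ring
  -- Competitor: `μ i` restricted to `Bᶜ` and rescaled to full mass. The mean over `Bᶜ` is then at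
  -- least the overall mean, hence the mean over `B` is at most it.
  · have hc : (μ i) Set.univ / (μ i) Bᶜ ≠ ⊤ := ENNReal.div_ne_top (measure_ne_top _ _) hBc
    have hν := mem_measureClass_of_le_smul (hμ.1.1 i) hc
      (ν := ((μ i) Set.univ / (μ i) Bᶜ) • (μ i).restrict Bᶜ) (by
        gcongr
        exact Measure.restrict_le_self)
    have hle := hμ.integral_totalPotential_le hΔ hC hQ hν
      ⟨Measure.ae_smul_measure (ae_restrict_of_ae hμQ.1) _,
        hμQ.2.restrict.smul_measure hc⟩ (by
        rw [Measure.smul_apply, Measure.restrict_apply_univ, smul_eq_mul,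
          ENNReal.div_mul_cancel hBc (measure_ne_top _ _)])
    rw [integral_smul_measure, ENNReal.toReal_div, ← measureReal_def, ← measureReal_def,
      smul_eq_mul, div_mul_eq_mul_div, le_div_iff₀ (by
        rw [measureReal_def, ENNReal.toReal_pos_iff]
        exact ⟨pos_iff_ne_zero.2 hBc, measure_lt_top _ _⟩)] at hle
    rw [← hh, ← hsplit] at hle
    rw [← hsplit]
    have hb : (μ i).real Bᶜ = (μ i).real Set.univ - (μ i).real B := by linarith
    rw [hb] at hle
    linarith

end EulerLagrange

/-! ### The tail condition and compactness of the supports. -/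

section CompactSupport

variable {d : ℕ} {Δ : Fin d → Set ℂ} {C : Matrix (Fin d) (Fin d) ℝ} {K : Set (Fin d → ℝ)}
  {Q : Fin d → ℂ → EReal} {μ : Fin d → Measure ℂ}

theorem neg_le_realPotential {ν : Measure ℂ} [IsFiniteMeasure ν]
    (hlog : Integrable (fun t : ℂ => Real.log (1 + ‖t‖)) ν) {z : ℂ}
    (hz : Integrable (realKernel z) ν) :
    -(ν.real Set.univ * Real.log (1 + ‖z‖) + ∫ w, Real.log (1 + ‖w‖) ∂ν) ≤ realPotential ν z := by
  have h : ∫ w, -(Real.log (1 + ‖z‖) + Real.log (1 + ‖w‖)) ∂ν ≤ ∫ w, realKernel z w ∂ν :=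
    integral_mono ((integrable_const _).add hlog).neg hz fun w =>
      neg_le.1 (neg_realKernel_le z w)
  rwa [integral_neg, integral_add (integrable_const _) hlog, integral_const, smul_eq_mul] at h

theorem realPotential_nonpos {ν : Measure ℂ} {R : ℝ} (hν : ∀ᵐ w ∂ν, ‖w‖ ≤ R) {z : ℂ}
    (hz : R + 1 ≤ ‖z‖) : realPotential ν z ≤ 0 := by
  refine integral_nonpos_of_ae (hν.mono fun w hw => ?_)
  have : 1 ≤ ‖z - w‖ := by linarith [norm_sub_norm_le z w]
  exact neg_nonpos.2 (Real.log_nonneg this)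

theorem isCompact_support_of_ae_norm_le {ν : Measure ℂ} {R : ℝ} (h : ∀ᵐ z ∂ν, ‖z‖ ≤ R) :
    IsCompact ν.support :=
  (isCompact_closedBall (0 : ℂ) R).of_isClosed_subset Measure.isClosed_support
    ((support_subset_iff_ae Metric.isClosed_closedBall).2 (h.mono fun z hz => by simpa using hz))

/-- The lower bound on the tails which characterizes compactness of the supports. -/
def TailBound (Δ : Fin d → Set ℂ) (C : Matrix (Fin d) (Fin d) ℝ) (Q : Fin d → ℂ → EReal)
    (μ : Fin d → Measure ℂ) (α M : ℝ) : Prop :=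
  ∀ i j, ¬ Bornology.IsBounded (Δ i) → ¬ Bornology.IsBounded (Δ j) → C i j < 0 →
    ∀ᵐ z ∂(μ i), z ∈ Δ i \ Metric.closedBall 0 M →
      (α : EReal) ≤ (C i j : EReal) * potential (μ j) z + Q i z / ((d : ℝ) : EReal)

theorem tailBound_of_isCompact_support (h : ∀ i, IsCompact (μ i).support) :
    ∃ α M : ℝ, 0 < M ∧ TailBound Δ C Q μ α M := by
  obtain ⟨M, hM0, hM⟩ := (Bornology.isBounded_iUnion.2 fun i =>
    (h i).isBounded).exists_pos_norm_le
  refine ⟨0, M, hM0, fun i j _ _ _ => ?_⟩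
  filter_upwards [(μ i).support_mem_ae] with z hz hzM
  exact absurd (by simpa using hM z (Set.mem_iUnion.2 ⟨i, hz⟩)) hzM.2

/-- Each `j ≠ i` receives the share `Q i / d`. The term `j = i` gets none, which leaves one share to
produce the contradiction in `IsSolution.isCompact_support`. -/
theorem exists_ae_component_lower_bound (hμ : ∀ i, μ i ∈ measureClass (Δ i))
    (hCdiag : ∀ i, 0 ≤ C i i) {α M : ℝ} (hT : TailBound Δ C Q μ α M) {i : Fin d}
    (hi : ¬ Bornology.IsBounded (Δ i)) (hQ : Admissible (Δ i) (Q i))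
    (hQfin : FiniteField (Q i) (μ i)) (j : Fin d) :
    ∃ A R : ℝ, ∀ᵐ z ∂(μ i), R ≤ ‖z‖ → -(A * (1 + Real.log (1 + ‖z‖)))
      ≤ C i j * realPotential (μ j) z + if j = i then 0 else (Q i z).toReal / d := by
  have hfin := (hμ j).1
  have hae := ae_mem_of_mem_measureClass (hμ i)
  obtain ⟨R, -, hR⟩ := hQ.mul_log_le 0
  have hd : (0 : ℝ) < d := by exact_mod_cast Fin.pos i
  have hq : ∀ᵐ z ∂(μ i), R ≤ ‖z‖ → 0 ≤ if j = i then 0 else (Q i z).toReal / (d : ℝ) := by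
    filter_upwards [hae, hQfin.1] with z hz hQz hzR
    have h0 := hR z hz hzR
    rw [hQz, zero_mul, EReal.coe_le_coe_iff] at h0
    split_ifs
    · exact le_rfl
    · exact div_nonneg h0 hd.le
  -- For `C i j ≥ 0` the potential is bounded below by a multiple of `-(1 + log (1 + |z|))`, and the
  -- share of `Q i` is nonnegative far out.
  rcases le_or_gt 0 (C i j) with hc | hc
  · set m := (μ j).real Set.univ with hm
    set l := ∫ w, Real.log (1 + ‖w‖) ∂(μ j) with hl
    have hm0 : 0 ≤ m := measureReal_nonneg
    have hl0 : 0 ≤ l := integral_nonneg fun w => log_one_add_norm_nonneg w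
    refine ⟨C i j * (m + l), R, ?_⟩
    filter_upwards [hq, ae_integrable_realKernel (hμ i) (hμ j)] with z hqz hz hzR
    have h1 := mul_le_mul_of_nonneg_left (neg_le_realPotential (hμ j).2.2.1 hz) hc
    have h2 := log_one_add_norm_nonneg z
    have h3 := mul_nonneg hc (add_nonneg hm0 (mul_nonneg hl0 h2))
    have h4 := hqz hzR
    linarith
  · have hji : j ≠ i := by
      rintro rfl
      exact absurd (hCdiag j) hc.not_ge
    -- For bounded `Δ j` the potential is nonpositive at distance at least `1` from a disc
    -- containing `Δ j`, so its product with `C i j < 0` is nonnegative. Only unbounded `Δ j` needs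
    -- the tail condition.
    by_cases hj : Bornology.IsBounded (Δ j)
    · obtain ⟨B, hB⟩ := hj.exists_norm_le
      refine ⟨0, max R (B + 1), ?_⟩
      filter_upwards [hq] with z hqz hzR
      have h1 := realPotential_nonpos ((ae_mem_of_mem_measureClass (hμ j)).mono hB)
        ((le_max_right _ _).trans hzR)
      have h2 := hqz ((le_max_left _ _).trans hzR)
      have h3 := mul_nonneg_of_nonpos_of_nonpos hc.le h1
      linarith
    · refine ⟨|α|, M + 1, ?_⟩
      filter_upwards [hT i j hi hj hc, hae, hQfin.1, ae_potential_eq (hμ i) (hμ j)]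
        with z hTz hz hQz hpot hzM
      have h1 := hTz ⟨hz, by simp only [mem_closedBall_zero_iff]; linarith⟩
      rw [hpot, hQz, ← EReal.coe_div, ← EReal.coe_mul, ← EReal.coe_add,
        EReal.coe_le_coe_iff] at h1
      rw [if_neg hji]
      have h2 := mul_nonneg (abs_nonneg α) (log_one_add_norm_nonneg z)
      linarith [neg_abs_le α]

theorem one_add_log_one_add_le {x : ℝ} (hx : 3 ≤ x) :
    1 ≤ Real.log x ∧ 1 + Real.log (1 + x) ≤ 3 * Real.log x := by
  have h1 : 1 ≤ Real.log x := by
    rw [Real.le_log_iff_exp_le (by linarith)]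
    linarith [Real.exp_one_lt_d9]
  have h2 : Real.log (1 + x) ≤ 2 * Real.log x := by
    rw [show 2 * Real.log x = Real.log (x ^ 2) by rw [Real.log_pow]; norm_num]
    exact Real.log_le_log (by linarith) (by nlinarith)
  exact ⟨h1, by linarith⟩

theorem IsSolution.isCompact_support (hΔ : ∀ i, IsClosed (Δ i)) (hC : C.PosSemidef)
    (hQ : ∀ i, Admissible (Δ i) (Q i)) (hμ : IsSolution C Δ K Q μ) {α M : ℝ}
    (hT : TailBound Δ C Q μ α M) (i : Fin d) : IsCompact (μ i).support := by
  by_cases hi : Bornology.IsBounded (Δ i)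
  · exact (Metric.isCompact_of_isClosed_isBounded (hΔ i) hi).of_isClosed_subset
      Measure.isClosed_support (hμ.1.1 i).2.1
  have hQfin := hμ.finiteField hΔ hQ i
  have hsymm : ∀ k l, C k l = C l k := fun k l => by simpa using hC.isHermitian.apply l k
  obtain ⟨F, hF⟩ := hμ.exists_ae_totalPotential_le hΔ hsymm hQ i
  choose A R hAR using exists_ae_component_lower_bound hμ.1.1 (fun k => hC.diag_nonneg) hT hi
    (hQ i) hQfin
  have hd : (0 : ℝ) < d := by exact_mod_cast Fin.pos i
  -- The slope makes `Q i / d` exceed `3 ∑ |A j| log |z|`, the total loss of the components, by at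
  -- least `(|F| + 1) log |z| ≥ |F| + 1`. The `3` comes from `one_add_log_one_add_le`.
  obtain ⟨R', -, hR'⟩ := (hQ i).mul_log_le (d * (3 * ∑ j, |A j| + |F| + 1))
  refine isCompact_support_of_ae_norm_le (R := 3 + |R'| + ∑ j, |R j|) ?_
  filter_upwards [hF, ae_all_iff.2 hAR, ae_mem_of_mem_measureClass (hμ.1.1 i), hQfin.1]
    with z hFz hARz hz hQz
  by_contra! hzR
  have hRsum : 0 ≤ ∑ j, |R j| := Finset.sum_nonneg fun j _ => abs_nonneg _
  have hAsum : 0 ≤ ∑ j, |A j| := Finset.sum_nonneg fun j _ => abs_nonneg _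
  have hz3 : 3 ≤ ‖z‖ := by linarith [abs_nonneg R']
  obtain ⟨hl1, hl2⟩ := one_add_log_one_add_le hz3
  have hq := hR' z hz (by linarith [le_abs_self R'])
  rw [hQz, EReal.coe_le_coe_iff] at hq
  set q := (Q i z).toReal with hqdef
  have hsum : ∑ j, -(|A j| * (1 + Real.log (1 + ‖z‖)))
      ≤ ∑ j, (C i j * realPotential (μ j) z + if j = i then 0 else q / d) := by
    refine Finset.sum_le_sum fun j _ => le_trans ?_ (hARz j ?_)
    · have := log_one_add_norm_nonneg z
      exact neg_le_neg (mul_le_mul_of_nonneg_right (le_abs_self _) (by linarith))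
    · have h1 : |R j| ≤ ∑ j, |R j| :=
        Finset.single_le_sum (f := fun j => |R j|) (fun j _ => abs_nonneg _) (Finset.mem_univ j)
      linarith [le_abs_self (R j), abs_nonneg R']
  -- The shares handed out add up to all of `Q i` but one share.
  have hite : ∑ j : Fin d, (if j = i then 0 else q / d) = q - q / d := by
    have h : ∀ j : Fin d, (if j = i then 0 else q / d) = q / d - if j = i then q / d else 0 := by
      intro j
      split_ifs <;> ring
    simp only [h, Finset.sum_sub_distrib, Finset.sum_ite_eq', Finset.mem_univ, if_true,
      Finset.sum_const, Finset.card_univ, Fintype.card_fin, nsmul_eq_mul]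
    rw [mul_div_cancel₀ _ hd.ne']
  rw [Finset.sum_add_distrib, hite, Finset.sum_neg_distrib, ← Finset.sum_mul] at hsum
  rw [totalPotential] at hFz
  have hqd : (3 * ∑ j, |A j| + |F| + 1) * Real.log ‖z‖ ≤ q / d := by
    rw [le_div_iff₀ hd]
    linarith
  have h5 := mul_le_mul_of_nonneg_left hl2 hAsum
  have h6 := mul_le_mul_of_nonneg_left hl1 (abs_nonneg F)
  linarith [le_abs_self F]

end CompactSupport

end VectorEquilibrium

theorem mainTheorem4 {d : ℕ} (Δ : Fin d → Set ℂ) (C : Matrix (Fin d) (Fin d) ℝ)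
    (K : Set (Fin d → ℝ)) (Q : Fin d → ℂ → EReal) (μ : Fin d → Measure ℂ)
    (hΔ_closed : ∀ i, IsClosed (Δ i))
    (hΔ_cap : ∀ i, 0 < VectorEquilibrium.logCapacity (Δ i))
    (hΔ_union : (⋃ i, Δ i) ≠ Set.univ)
    (hC : C.PosSemidef)
    (hK_compact : IsCompact K) (hK_nonempty : K.Nonempty) (hK_nonneg : ∀ x ∈ K, ∀ i, 0 ≤ x i)
    (hQ : ∀ i, VectorEquilibrium.Admissible (Δ i) (Q i))
    (hμ : VectorEquilibrium.IsSolution C Δ K Q μ) :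
    (∀ i, IsCompact (μ i).support) ↔
      ∃ α M : ℝ, 0 < M ∧ ∀ i j, ¬ Bornology.IsBounded (Δ i) → ¬ Bornology.IsBounded (Δ j) →
        C i j < 0 →
        ∀ᵐ z ∂(μ i), z ∈ Δ i \ Metric.closedBall 0 M →
          (α : EReal) ≤ (C i j : EReal) * VectorEquilibrium.potential (μ j) z
            + Q i z / ((d : ℝ) : EReal) :=
  ⟨VectorEquilibrium.tailBound_of_isCompact_support,
    fun ⟨_, _, _, hT⟩ i => hμ.isCompact_support hΔ_closed hC hQ hT i⟩
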